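/- Let $D$ be a nonempty connected alternating link diagram (connected means that the underlying plane curve system is connected; it may have no crossings, in which case $D$ is a single circle). The positive smoothing of a crossing is the one that joins the two regions swept out when the over-strand is rotated counterclockwise; the negative smoothing is the other one. A state $s$ assigns to each crossing $0$ (positive smoothing) or $1$ (negative smoothing); $|s|$ is the number of circles after smoothing, and $\sigma(s)$ is the number of positive minus the number of negative smoothings. Let $$\langle D\rangle=\sum_s A^{\sigma(s)}\,(-A^2-A^{-2})^{|s|}=\sum_j a_jA^j$$ be the Kauffman bracket (so a crossingless circle has bracket $-A^2-A^{-2}$). The diagram is plus-adequate if the state with all entries $0$ has more circles than every state with exactly one entry $1$, and minus-adequate if the state with all entries $1$ has more circles than every state with exactly one entry $0$. Colour the regions of $D$ in checkerboard fashion so that the regions swept out by rotating the over-strand of any crossing counterclockwise are black and the others are white (for a crossingless circle, one side is black and the other white). Let $G$ be the graph whose vertices are the black regions, with one edge for each crossing, joining the two black regions that have corners there; let $G^*$ be the graph obtained in the same way from the white regions. For a graph $H$, two edges are parallel if they connect the same vertices; $\tilde H$ has the vertices of $H$ and one edge for each class of parallel edges; and $\psi(H)=|E(H)|-|V(H)|+1$.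 Theorem. If $D$ is plus-adequate, then $\langle D\rangle$ has a highest degree $k$ with $a_k\neq0$, and $|a_{k-4}-a_k|=\psi(\widetilde{G^*})$. If $D$ is minus-adequate, then $\langle D\rangle$ has a lowest degree $l$ with $a_l\neq0$, and $|a_{l+4}-a_l|=\psi(\tilde G)$. -/

import Mathlib

open scoped LaurentPolynomial

/-- A 4-valent map on closed oriented surfaces with over/under information, together with finitely
many crossingless circles. The four ends `(c, 0), (c, 1), (c, 2), (c, 3)` of the crossing `c` are
listed counterclockwise; `(c, 1), (c, 3)` are the ends of the over-strand and `(c, 0), (c, 2)` are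
the ends of the under-strand. The edges of the diagram are the pairs `{d, glue d}`. -/
structure CrossingMap where
  /-- the number of crossings -/
  n : ℕ
  /-- the number of components that are simple closed curves without crossings -/
  loops : ℕ
  /-- the other end of the edge that starts at a given end of a crossing -/
  glue : Fin n × ZMod 4 → Fin n × ZMod 4
  glue_glue : ∀ d, glue (glue d) = d
  glue_ne : ∀ d, glue d ≠ d

namespace CrossingMap

/-- The ends at the crossings. -/
abbrev Dart (D : CrossingMap) : Type := Fin D.n × ZMod 4

/-- The end belongs to the over-strand of its crossing. -/
def IsOver {D : CrossingMap} (d : D.Dart) : Prop := d.2 = 1 ∨ d.2 = 3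

instance {D : CrossingMap} (d : D.Dart) : Decidable (IsOver d) :=
  inferInstanceAs (Decidable (d.2 = 1 ∨ d.2 = 3))

/-- The connected components of the 4-valent graph (crossingless circles not included). -/
def Component (D : CrossingMap) : Type :=
  Quot fun d e : D.Dart => e = D.glue d ∨ e = (d.1, d.2 + 1)

/-- The pair `(c, i)` also names the corner at the crossing `c` between the ends `(c, i)` and
`(c, i + 1)`. The face of this corner lies to the left of the edge that leaves `c` at `(c, i)`;
`nextCorner` is the corner that one meets in this face at the other end of that edge. -/
def nextCorner (D : CrossingMap) (d : D.Dart) : D.Dart :=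
  ((D.glue d).1, (D.glue d).2 - 1)

/-- The faces of the 4-valent map. -/
def Face (D : CrossingMap) : Type :=
  Quot fun d e : D.Dart => e = D.nextCorner d

end CrossingMap

/-- A link diagram: every component of the 4-valent map is drawn on a sphere,
`#vertices - #edges + #faces = 2 * #components`, where `#edges = 2 * #vertices`. -/
structure LinkDiagram extends CrossingMap where
  planar : (n : ℤ) - 2 * n + Nat.card toCrossingMap.Face = 2 * Nat.card toCrossingMap.Component

namespace LinkDiagram

open CrossingMap

/-- The underlying plane curve system is nonempty and connected. -/
def Connected (D : LinkDiagram) : Prop :=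
  Nat.card D.Component + D.loops = 1

/-- Along the link over- and under-passes alternate: each edge has one end on an over-strand and
the other one on an under-strand. -/
def Alternating (D : LinkDiagram) : Prop :=
  ∀ d : D.Dart, IsOver (D.glue d) ↔ ¬ IsOver d

/-! ### States and the Kauffman bracket -/

/-- A state: the crossings with entry `0` are smoothed positively, those with entry `1`
negatively. -/
abbrev State (D : LinkDiagram) : Type := Fin D.n → Fin 2

/-- The end to which a given end is joined at its crossing. The positive smoothing joins the two
regions swept out by the over-strand when it is rotated counterclockwise, that is, the corners
between `(c, 1), (c, 2)` and between `(c, 3), (c, 0)`; so it connects `(c, 0)` with `(c, 1)` and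
`(c, 2)` with `(c, 3)`. The negative smoothing connects `(c, 1)` with `(c, 2)` and `(c, 3)`
with `(c, 0)`. -/
def smooth (D : LinkDiagram) (s : D.State) (d : D.Dart) : D.Dart :=
  if s d.1 = 0 then
    if IsOver d then (d.1, d.2 - 1) else (d.1, d.2 + 1)
  else
    if IsOver d then (d.1, d.2 + 1) else (d.1, d.2 - 1)

/-- The number `|s|` of circles of the state `s`. -/
noncomputable def circles (D : LinkDiagram) (s : D.State) : ℕ :=
  Nat.card (Quot fun d e : D.Dart => e = D.glue d ∨ e = D.smooth s d) + D.loops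

/-- The number of positive smoothings minus the number of negative smoothings. -/
def sigma (D : LinkDiagram) (s : D.State) : ℤ :=
  ((Finset.univ.filter fun c => s c = 0).card : ℤ) - (Finset.univ.filter fun c => s c = 1).card

/-- The Kauffman bracket `∑ₛ A ^ σ(s) * (-A² - A⁻²) ^ |s|` (the variable `A` is `T 1`); the empty
diagram has bracket `1`, the crossingless circle has bracket `-A² - A⁻²`. -/
noncomputable def bracket (D : LinkDiagram) : ℤ[T;T⁻¹] :=
  ∑ s : D.State, LaurentPolynomial.T (D.sigma s) *
    (-LaurentPolynomial.T 2 - LaurentPolynomial.T (-2)) ^ D.circles s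

/-- The coefficient `a_j` of `A ^ j` in the Kauffman bracket. -/
noncomputable def coeff (D : LinkDiagram) (j : ℤ) : ℤ := D.bracket.coeff j

/-- The state with all `0` smoothings has more circles than any state with only one `1`
smoothing. -/
def PlusAdequate (D : LinkDiagram) : Prop :=
  ∀ c : Fin D.n, D.circles (Function.update (fun _ => 0) c 1) < D.circles fun _ => 0

/-- The state with all `1` smoothings has more circles than any state with only one `0`
smoothing. -/
def MinusAdequate (D : LinkDiagram) : Prop :=
  ∀ c : Fin D.n, D.circles (Function.update (fun _ => 1) c 0) < D.circles fun _ => 1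

/-! ### Checkerboard graphs

The following notions are meant for connected alternating diagrams, for which every region has
corners of one colour only. -/

/-- The regions of a connected diagram: the faces of the 4-valent map, or the two sides of
the single circle if there is no crossing. -/
abbrev Region (D : LinkDiagram) : Type := D.Face ⊕ (Fin D.loops × Bool)

/-- The region that contains the corner between `(c, i)` and `(c, i + 1)`. -/
def cornerRegion (D : LinkDiagram) (c : Fin D.n) (i : ZMod 4) : D.Region :=
  Sum.inl (Quot.mk _ (c, i))

/-- The black regions: those swept out by rotating the over-strand of a crossing counterclockwise.
A crossingless circle is coloured black on one side and white on the other side. -/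
def blackRegions (D : LinkDiagram) : Set D.Region :=
  {r | (∃ c, r = D.cornerRegion c 1 ∨ r = D.cornerRegion c 3) ∨ ∃ j, r = Sum.inr (j, true)}

/-- The white regions. -/
def whiteRegions (D : LinkDiagram) : Set D.Region :=
  {r | (∃ c, r = D.cornerRegion c 0 ∨ r = D.cornerRegion c 2) ∨ ∃ j, r = Sum.inr (j, false)}

/-- The checkerboard graph `G`: its vertices are the black regions, and each crossing is an edge
between the two black regions that have a corner there. -/
def blackGraph (D : LinkDiagram) : Graph D.Region (Fin D.n) where
  vertexSet := D.blackRegions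
  IsLink c x y := s(x, y) = s(D.cornerRegion c 1, D.cornerRegion c 3)
  isLink_symm := fun _ _ => ⟨fun _ _ h => Sym2.eq_swap.trans h⟩
  eq_or_eq_of_isLink_of_isLink := by
    intro e x y v w h h'
    have := h.trans h'.symm
    rw [Sym2.eq_iff] at this
    tauto
  left_mem_of_isLink := by
    intro e x y h
    rw [Sym2.eq_iff] at h
    exact Or.inl ⟨e, by tauto⟩

/-- The dual checkerboard graph `G*`: its vertices are the white regions, and each crossing is an
edge between the two white regions that have a corner there. -/
def whiteGraph (D : LinkDiagram) : Graph D.Region (Fin D.n) where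
  vertexSet := D.whiteRegions
  IsLink c x y := s(x, y) = s(D.cornerRegion c 0, D.cornerRegion c 2)
  isLink_symm := fun _ _ => ⟨fun _ _ h => Sym2.eq_swap.trans h⟩
  eq_or_eq_of_isLink_of_isLink := by
    intro e x y v w h h'
    have := h.trans h'.symm
    rw [Sym2.eq_iff] at this
    tauto
  left_mem_of_isLink := by
    intro e x y h
    rw [Sym2.eq_iff] at h
    exact Or.inl ⟨e, by tauto⟩

end LinkDiagram

namespace Graph

variable {α β : Type*}

/-- Two edges are parallel if they connect the same vertices. -/
def Parallel (G : Graph α β) (e f : β) : Prop :=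
  ∃ x y, G.IsLink e x y ∧ G.IsLink f x y

/-- The reduced graph: the same vertices, and one edge for each class of parallel edges. -/
def reduced (G : Graph α β) : Graph α (Set β) where
  vertexSet := G.vertexSet
  IsLink p x y := ∃ e, G.IsLink e x y ∧ p = {f | G.Parallel e f}
  isLink_symm := fun _ _ => ⟨fun _ _ ⟨e, h, hp⟩ => ⟨e, h.symm, hp⟩⟩
  eq_or_eq_of_isLink_of_isLink := by
    rintro p x y v w ⟨e, h, rfl⟩ ⟨f, h', hp⟩
    have hf : f ∈ {g | G.Parallel e g} := hp ▸ ⟨v, w, h', h'⟩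
    obtain ⟨a, b, hea, hfa⟩ := hf
    rcases hea.eq_and_eq_or_eq_and_eq h with ⟨rfl, rfl⟩ | ⟨rfl, rfl⟩
    · exact hfa.left_eq_or_eq h'
    · exact hfa.symm.left_eq_or_eq h'
  left_mem_of_isLink := fun _ _ _ ⟨_, h, _⟩ => h.left_mem

/-- `ψ(G) = |E| - |V| + 1`. -/
noncomputable def psi (G : Graph α β) : ℤ :=
  (G.edgeSet.ncard : ℤ) - G.vertexSet.ncard + 1

end Graph

/-! ### Counting classes of a generated equivalence relation. -/

section QuotCard

variable {X : Type*}

/-! Fix a constant state `t`. Let `V` be its circles, and let each crossing be an edge between the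
two circles that meet there. Since `D` is alternating, these circles bound the regions of one
colour, so this graph is `G*` for `t = 0` and `G` for `t = 1`. Other states are edge sets `S`, the
crossings with entry `t + 1`. Write `b S` for the number of circles and `c S` for the number of
components of `(V, S)`.

The key identity is `b S + |V| = 2 c S + |S|` (`circleCount_eq`). The defect of the identity never
decreases when an edge is added to `S`. It vanishes at `∅`, and by Euler's formula and connectedness
it is at most `0` at the full set, so it is `0` throughout.

Hence, for `t = 0`, the term of `S` has top degree `n + 4 c S - 2 |V|`. Adequacy excludes loops, so
`S = ∅` alone reaches `k = n + 2 |V|`, with coefficient `(-1)^|V|`. In degree `k - 4`, the empty set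
gives `(-1)^|V| |V|`; the other contributions come from nonempty sets of mutually parallel edges,
and their signs add up to `-(-1)^|V|` for each parallel class. Subtracting the two coefficients
leaves `ψ` of the reduced graph up to sign. The case `t = 1` follows through `A ↦ A⁻¹`. -/

theorem card_quot_le [Finite X] {r r' : X → X → Prop}
    (h : ∀ x y, r x y → Quot.mk r' x = Quot.mk r' y) : Nat.card (Quot r') ≤ Nat.card (Quot r) :=
  Nat.card_le_card_of_surjective (Quot.lift (Quot.mk r') h)
    fun q => Quot.inductionOn q fun x => ⟨Quot.mk r x, rfl⟩

/-- The relation `r`, enlarged by the pair `(a, b)`. -/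
def addPair (r : X → X → Prop) (a b : X) : X → X → Prop := fun x y => r x y ∨ (x = a ∧ y = b)

theorem addPair_sound (r : X → X → Prop) (a b : X) :
    Quot.mk (addPair r a b) a = Quot.mk (addPair r a b) b :=
  Quot.sound (Or.inr ⟨rfl, rfl⟩)

theorem mk_addPair_of_mk {r : X → X → Prop} {x y : X} (a b : X) (h : Quot.mk r x = Quot.mk r y) :
    Quot.mk (addPair r a b) x = Quot.mk (addPair r a b) y :=
  congrArg (Quot.lift (Quot.mk (addPair r a b)) fun _ _ h => Quot.sound (Or.inl h)) h

theorem card_quot_le_addPair [Finite X] (r : X → X → Prop) (a b : X) :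
    Nat.card (Quot r) ≤ Nat.card (Quot (addPair r a b)) + 1 := by
  classical
  rw [← Finite.card_option]
  -- Moving the class of `a` onto that of `b` is well defined after the enlargement and misses at
  -- most the class of `a`, which `none` supplies.
  let φ : Quot (addPair r a b) → Quot r :=
    Quot.lift (fun x => if Quot.mk r x = Quot.mk r a then Quot.mk r b else Quot.mk r x) <| by
      rintro x y (h | ⟨rfl, rfl⟩)
      · simp [Quot.sound h]
      · simp
  refine Nat.card_le_card_of_surjective (fun o => o.elim (Quot.mk r a) φ) fun q => ?_
  induction q using Quot.ind with | mk x => ?_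
  by_cases h : Quot.mk r x = Quot.mk r a
  · exact ⟨none, h.symm⟩
  · exact ⟨some (Quot.mk _ x), if_neg h⟩

theorem card_addPair_lt [Finite X] {r : X → X → Prop} {a b : X} (h : Quot.mk r a ≠ Quot.mk r b) :
    Nat.card (Quot (addPair r a b)) + 1 ≤ Nat.card (Quot r) := by
  classical
  have := Fintype.ofFinite (Quot r)
  have := Fintype.ofFinite (Quot (addPair r a b))
  rw [Nat.card_eq_fintype_card, Nat.card_eq_fintype_card]
  refine Fintype.card_lt_of_surjective_not_injective
    (Quot.lift (Quot.mk (addPair r a b)) fun _ _ h => Quot.sound (Or.inl h))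
    (fun q => Quot.inductionOn q fun x => ⟨Quot.mk r x, rfl⟩) fun hi => h (hi ?_)
  exact addPair_sound r a b

/-- An involution on a class of a relation generated by a fixed-point-free involution `α` and an
involution `β` has an even number of fixed points. -/
theorem even_card_fixed [Fintype X] [DecidableEq X] {α β : X → X} (hα : ∀ x, α (α x) = x)
    (hα' : ∀ x, α x ≠ x) (hβ : ∀ x, β (β x) = x) (p : X → Prop) [DecidablePred p]
    (hpα : ∀ x, p x → p (α x)) (hpβ : ∀ x, p x → p (β x)) :
    Even (Finset.univ.filter fun x => p x ∧ β x = x).card := by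
  -- Modulo 2, `α` cancels the whole class in pairs and `β` cancels its non-fixed points.
  have h1 : ∑ _x ∈ Finset.univ.filter p, (1 : ZMod 2) = 0 :=
    Finset.sum_involution (fun x _ => α x) (fun _ _ => by decide) (fun x _ _ => hα' x)
      (fun x hx => by simpa using hpα x (by simpa using hx)) (fun x _ => hα x)
  have h2 : ∑ _x ∈ (Finset.univ.filter p).filter (fun x => ¬ β x = x), (1 : ZMod 2) = 0 :=
    Finset.sum_involution (fun x _ => β x) (fun _ _ => by decide)
      (fun x hx _ => (Finset.mem_filter.1 hx).2)
      (fun x hx => by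
        simp only [Finset.mem_filter, Finset.mem_univ, true_and] at hx ⊢
        exact ⟨hpβ x hx.1, by rw [hβ]; exact fun h => hx.2 h.symm⟩) (fun x _ => hβ x)
  rw [← Finset.sum_filter_add_sum_filter_not _ (fun x => β x = x), h2, add_zero,
    Finset.filter_filter] at h1
  rw [Finset.sum_const, nsmul_eq_mul, mul_one] at h1
  exact (ZMod.natCast_eq_zero_iff_even).1 h1

theorem pairing_of_even {Q : Type*} [DecidableEq Q] {q₀ q₁ q₂ q₃ : Q}
    (h : ∀ z, Even ((if q₀ = z then 1 else 0) + (if q₁ = z then 1 else 0) +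
      (if q₂ = z then 1 else 0) + (if q₃ = z then 1 else 0))) :
    (q₀ = q₁ ∧ q₂ = q₃) ∨ (q₀ = q₂ ∧ q₁ = q₃) ∨ (q₀ = q₃ ∧ q₁ = q₂) := by
  have h0 := Nat.even_iff.1 (h q₀)
  have h1 := Nat.even_iff.1 (h q₁)
  have h2 := Nat.even_iff.1 (h q₂)
  clear h
  grind

/-- If `β` has exactly four fixed points, then the paths of `α` and `β` join them in pairs. -/
theorem pairing_of_involutions [Finite X] {α β : X → X} (hα : ∀ x, α (α x) = x)
    (hα' : ∀ x, α x ≠ x) (hβ : ∀ x, β (β x) = x) {r : X → X → Prop}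
    (hr : ∀ x y, r x y ↔ y = α x ∨ y = β x) {a : Fin 4 → X} (ha : Function.Injective a)
    (hfix : ∀ x, β x = x ↔ ∃ i, a i = x) :
    (Quot.mk r (a 0) = Quot.mk r (a 1) ∧ Quot.mk r (a 2) = Quot.mk r (a 3)) ∨
    (Quot.mk r (a 0) = Quot.mk r (a 2) ∧ Quot.mk r (a 1) = Quot.mk r (a 3)) ∨
    (Quot.mk r (a 0) = Quot.mk r (a 3) ∧ Quot.mk r (a 1) = Quot.mk r (a 2)) := by
  classical
  have := Fintype.ofFinite X
  have key (q : Quot r) : Even (Finset.univ.filter fun i => Quot.mk r (a i) = q).card := by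
    have h := even_card_fixed hα hα' hβ (fun x => Quot.mk r x = q)
      (fun x hx => by rw [← hx]; exact (Quot.sound ((hr _ _).2 (Or.inl rfl))).symm)
      (fun x hx => by rw [← hx]; exact (Quot.sound ((hr _ _).2 (Or.inr rfl))).symm)
    convert h using 1
    rw [← Finset.card_image_of_injective _ ha]
    congr 1
    ext x
    simp only [Finset.mem_image, Finset.mem_filter, Finset.mem_univ, true_and, hfix]
    constructor
    · rintro ⟨i, hi, rfl⟩
      exact ⟨hi, i, rfl⟩
    · rintro ⟨hx, i, rfl⟩
      exact ⟨i, hx, rfl⟩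
  simp only [Finset.card_filter, Fin.sum_univ_four] at key
  exact pairing_of_even key

variable [Finite X] {r R R' : X → X → Prop} {a : Fin 4 → X}

/-- If the outer arcs already join `0` to `1` and `2` to `3`, then `R` merges nothing beyond `r`.
For the other two pairings, joining `0` to `1` also joins `2` to `3`, so `R` costs at most one
class. -/
theorem card_quot_reconnect_le
    (h : (Quot.mk r (a 0) = Quot.mk r (a 1) ∧ Quot.mk r (a 2) = Quot.mk r (a 3)) ∨
      (Quot.mk r (a 0) = Quot.mk r (a 2) ∧ Quot.mk r (a 1) = Quot.mk r (a 3)) ∨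
      (Quot.mk r (a 0) = Quot.mk r (a 3) ∧ Quot.mk r (a 1) = Quot.mk r (a 2)))
    (hR : ∀ x y, R x y → r x y ∨ s(x, y) = s(a 0, a 1) ∨ s(x, y) = s(a 2, a 3))
    (hR' : ∀ x y, r x y → R' x y ∨ x = y) :
    Nat.card (Quot R') ≤ Nat.card (Quot R) + 1 := by
  have h1 : Nat.card (Quot R') ≤ Nat.card (Quot r) := card_quot_le fun x y hxy =>
    (hR' x y hxy).elim (fun h => Quot.sound h) (fun h => h ▸ rfl)
  have h2 : Nat.card (Quot (addPair r (a 0) (a 1))) ≤ Nat.card (Quot R) ∨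
      Nat.card (Quot r) ≤ Nat.card (Quot R) := by
    rcases h with ⟨h, h'⟩ | h
    · right
      refine card_quot_le fun x y hxy => ?_
      rcases hR x y hxy with h | h | h
      · exact Quot.sound h
      · rcases Sym2.eq_iff.1 h with ⟨rfl, rfl⟩ | ⟨rfl, rfl⟩ <;> simp [*]
      · rcases Sym2.eq_iff.1 h with ⟨rfl, rfl⟩ | ⟨rfl, rfl⟩ <;> simp [*]
    · left
      have h01 := addPair_sound r (a 0) (a 1)
      have h23 : Quot.mk (addPair r (a 0) (a 1)) (a 2) = Quot.mk (addPair r (a 0) (a 1)) (a 3) := by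
        rcases h with ⟨h, h'⟩ | ⟨h, h'⟩
        · rw [← mk_addPair_of_mk _ _ h, ← mk_addPair_of_mk _ _ h', h01]
        · rw [← mk_addPair_of_mk _ _ h, ← mk_addPair_of_mk _ _ h', h01]
      refine card_quot_le fun x y hxy => ?_
      rcases hR x y hxy with h | h | h
      · exact Quot.sound (Or.inl h)
      · rcases Sym2.eq_iff.1 h with ⟨rfl, rfl⟩ | ⟨rfl, rfl⟩ <;> simp [*]
      · rcases Sym2.eq_iff.1 h with ⟨rfl, rfl⟩ | ⟨rfl, rfl⟩ <;> simp [*]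
  have h3 := card_quot_le_addPair r (a 0) (a 1)
  omega

/-- The hypothesis `hne` leaves only the pairing in which the outer arcs join `0` to `1` and `2` to
`3`. Then `R` merges nothing, whereas `R'` merges the two arcs by joining `1` to `2`. -/
theorem card_quot_reconnect_lt
    (h : (Quot.mk r (a 0) = Quot.mk r (a 1) ∧ Quot.mk r (a 2) = Quot.mk r (a 3)) ∨
      (Quot.mk r (a 0) = Quot.mk r (a 2) ∧ Quot.mk r (a 1) = Quot.mk r (a 3)) ∨
      (Quot.mk r (a 0) = Quot.mk r (a 3) ∧ Quot.mk r (a 1) = Quot.mk r (a 2)))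
    (hR : ∀ x y, R x y → r x y ∨ s(x, y) = s(a 0, a 1) ∨ s(x, y) = s(a 2, a 3))
    (hRr : ∀ x y, r x y → R x y ∨ x = y) (hR23 : R (a 2) (a 3))
    (hR' : ∀ x y, r x y → R' x y ∨ x = y) (hR12 : R' (a 1) (a 2))
    (hne : Quot.mk R (a 0) ≠ Quot.mk R (a 2)) :
    Nat.card (Quot R') + 1 ≤ Nat.card (Quot R) := by
  have up {x y : X} (h : Quot.mk r x = Quot.mk r y) : Quot.mk R x = Quot.mk R y :=
    congrArg (Quot.lift (Quot.mk R) fun x y hxy =>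
      (hRr x y hxy).elim (fun h => Quot.sound h) (fun h => h ▸ rfl)) h
  rcases h with ⟨h, h'⟩ | ⟨h, -⟩ | ⟨h, -⟩
  · have h12 : Quot.mk r (a 1) ≠ Quot.mk r (a 2) := fun h'' => hne (up (h.trans h''))
    have h1 := card_addPair_lt h12
    have h2 : Nat.card (Quot R') ≤ Nat.card (Quot (addPair r (a 1) (a 2))) := by
      refine card_quot_le ?_
      rintro x y (hxy | ⟨rfl, rfl⟩)
      · exact (hR' x y hxy).elim (fun h => Quot.sound h) (fun h => h ▸ rfl)
      · exact Quot.sound hR12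
    have h3 : Nat.card (Quot r) ≤ Nat.card (Quot R) := by
      refine card_quot_le fun x y hxy => ?_
      rcases hR x y hxy with h | h | h
      · exact Quot.sound h
      · rcases Sym2.eq_iff.1 h with ⟨rfl, rfl⟩ | ⟨rfl, rfl⟩ <;> simp [*]
      · rcases Sym2.eq_iff.1 h with ⟨rfl, rfl⟩ | ⟨rfl, rfl⟩ <;> simp [*]
    omega
  · exact absurd (up h) hne
  · exact absurd ((up h).trans (Quot.sound hR23).symm) hne

end QuotCard

/-! ### Components and rank of a finite graph. -/

section ComponentCount

variable {V : Type*}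

/-- The number of components of the graph on `V` with edges `P`. -/
noncomputable def componentCount (P : Finset (Sym2 V)) : ℕ :=
  Nat.card (Quot fun x y : V => s(x, y) ∈ P)

theorem componentCount_empty : componentCount (∅ : Finset (Sym2 V)) = Nat.card V :=
  Nat.card_congr ⟨Quot.lift id (by simp), Quot.mk _, fun q => Quot.inductionOn q fun _ => rfl,
    fun _ => rfl⟩

variable [Finite V]

theorem componentCount_anti {P Q : Finset (Sym2 V)} (h : P ⊆ Q) :
    componentCount Q ≤ componentCount P :=
  card_quot_le fun _ _ hxy => Quot.sound (h hxy)

variable [DecidableEq V]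

theorem componentCount_le_insert (P : Finset (Sym2 V)) (e : Sym2 V) :
    componentCount P ≤ componentCount (insert e P) + 1 := by
  induction e using Sym2.ind with | _ a b => ?_
  refine (card_quot_le_addPair _ a b).trans (Nat.add_le_add_right (card_quot_le fun x y hxy => ?_) 1)
  rcases Finset.mem_insert.1 hxy with h | h
  · rcases Sym2.eq_iff.1 h with ⟨rfl, rfl⟩ | ⟨rfl, rfl⟩
    · exact addPair_sound _ _ _
    · exact (addPair_sound _ _ _).symm
  · exact Quot.sound (Or.inl h)

theorem componentCount_insert_lt {P : Finset (Sym2 V)} {a b : V}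
    (h : Quot.mk (fun x y : V => s(x, y) ∈ P) a ≠ Quot.mk _ b) :
    componentCount (insert s(a, b) P) + 1 ≤ componentCount P := by
  refine (Nat.add_le_add_right (card_quot_le ?_) 1).trans (card_addPair_lt h)
  rintro x y (hxy | ⟨rfl, rfl⟩)
  · exact Quot.sound (Finset.mem_insert_of_mem hxy)
  · exact Quot.sound (Finset.mem_insert_self _ _)

theorem card_le_componentCount_add (P : Finset (Sym2 V)) :
    Nat.card V ≤ componentCount P + P.card := by
  induction P using Finset.induction_on with
  | empty => simp [componentCount_empty]
  | insert e P he ih =>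
    have := componentCount_le_insert P e
    rw [Finset.card_insert_of_notMem he]
    omega

theorem componentCount_singleton_lt {a b : V} (h : a ≠ b) :
    componentCount {s(a, b)} + 1 ≤ Nat.card V := by
  rw [← componentCount_empty, ← insert_empty_eq]
  refine componentCount_insert_lt fun hq => h ?_
  exact congrArg (Quot.lift id (by simp)) hq

theorem componentCount_lt_of_nonempty {P : Finset (Sym2 V)} (hP : ∀ e ∈ P, ¬ e.IsDiag)
    (h : P.Nonempty) : componentCount P + 1 ≤ Nat.card V := by
  obtain ⟨e, he⟩ := h
  induction e using Sym2.ind with | _ a b => ?_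
  exact (Nat.add_le_add_right (componentCount_anti (Finset.singleton_subset_iff.2 he)) 1).trans
    (componentCount_singleton_lt fun hab => hP _ he (by simpa using hab))

theorem componentCount_add_two_le {P : Finset (Sym2 V)} (hP : ∀ e ∈ P, ¬ e.IsDiag)
    (h : 1 < P.card) : componentCount P + 2 ≤ Nat.card V := by
  obtain ⟨e, he, f, hf, hef⟩ := Finset.one_lt_card.1 h
  induction e using Sym2.ind with | _ a b => ?_
  induction f using Sym2.ind with | _ c d => ?_
  have hab : a ≠ b := fun h => hP _ he (by simpa using h)
  have hcd : c ≠ d := fun h => hP _ hf (by simpa using h)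
  have h1 := componentCount_singleton_lt hab
  have h2 : componentCount (insert s(c, d) {s(a, b)}) + 1 ≤ componentCount {s(a, b)} := by
    refine componentCount_insert_lt fun hq => ?_
    -- Contracting the edge `ab` onto `b` keeps `c` and `d` apart, because `cd` is neither a loop
    -- nor `ab`.
    have := congrArg (Quot.lift (fun x => if x = a then b else x) (by
      intro x y hxy
      rcases Sym2.eq_iff.1 (Finset.mem_singleton.1 hxy) with ⟨rfl, rfl⟩ | ⟨rfl, rfl⟩ <;> simp)) hq
    simp only at this
    rw [Ne, Sym2.eq_iff] at hef
    split_ifs at this <;> grind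
  have h3 : componentCount P ≤ componentCount (insert s(c, d) {s(a, b)}) :=
    componentCount_anti (by simp [Finset.insert_subset_iff, he, hf])
  omega

end ComponentCount

/-! ### Coefficients of powers of the circle value. -/

section CircleCoefficients

/-- The coefficient of `A ^ j` in `(-A² - A⁻²) ^ m`. -/
noncomputable def circleCoeff (m : ℕ) (j : ℤ) : ℤ :=
  ((-LaurentPolynomial.T 2 - LaurentPolynomial.T (-2) : ℤ[T;T⁻¹]) ^ m).coeff j

theorem coeff_T_mul (k : ℤ) (p : ℤ[T;T⁻¹]) (j : ℤ) :
    (LaurentPolynomial.T k * p).coeff j = p.coeff (j - k) := by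
  rw [LaurentPolynomial.T, AddMonoidAlgebra.coeff_single_mul_eq_mul_coeff (j - k), one_mul]
  intro i _
  omega

theorem circleCoeff_zero (j : ℤ) : circleCoeff 0 j = if j = 0 then 1 else 0 := by
  rw [circleCoeff, pow_zero, ← LaurentPolynomial.T_zero, LaurentPolynomial.T_apply]
  simp [eq_comm]

theorem circleCoeff_succ (m : ℕ) (j : ℤ) :
    circleCoeff (m + 1) j = -circleCoeff m (j - 2) - circleCoeff m (j + 2) := by
  simp only [circleCoeff, pow_succ', sub_mul, neg_mul]
  rw [AddMonoidAlgebra.coeff_sub, AddMonoidAlgebra.coeff_neg, Finsupp.sub_apply, Finsupp.neg_apply,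
    coeff_T_mul, coeff_T_mul, sub_neg_eq_add]

/-- The symmetry `A ↦ A⁻¹` of the circle value; it turns lowest degrees into highest ones. -/
theorem circleCoeff_neg (m : ℕ) (j : ℤ) : circleCoeff m (-j) = circleCoeff m j := by
  induction m generalizing j with
  | zero => simp [circleCoeff_zero]
  | succ m ih =>
    rw [circleCoeff_succ, circleCoeff_succ, ← ih (j - 2), ← ih (j + 2)]
    ring_nf

theorem circleCoeff_of_lt {m : ℕ} {j : ℤ} (h : 2 * (m : ℤ) < j) : circleCoeff m j = 0 := by
  induction m generalizing j with
  | zero => rw [circleCoeff_zero, if_neg (by push_cast at h; omega)]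
  | succ m ih =>
    push_cast at h
    rw [circleCoeff_succ, ih (by omega), ih (by omega)]
    simp

theorem circleCoeff_top (m : ℕ) : circleCoeff m (2 * m) = (-1) ^ m := by
  induction m with
  | zero => simp [circleCoeff_zero]
  | succ m ih =>
    rw [circleCoeff_succ, circleCoeff_of_lt (j := 2 * ((m + 1 : ℕ) : ℤ) + 2) (by push_cast; omega)]
    rw [show 2 * ((m + 1 : ℕ) : ℤ) - 2 = 2 * m by push_cast; ring, ih]
    ring

theorem circleCoeff_top_sub_four (m : ℕ) : circleCoeff m (2 * m - 4) = (-1) ^ m * m := by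
  induction m with
  | zero => simp [circleCoeff_zero]
  | succ m ih =>
    rw [circleCoeff_succ, show 2 * ((m + 1 : ℕ) : ℤ) - 4 - 2 = 2 * m - 4 by push_cast; ring,
      show 2 * ((m + 1 : ℕ) : ℤ) - 4 + 2 = 2 * m by push_cast; ring, ih, circleCoeff_top]
    push_cast
    ring

end CircleCoefficients

/-! ### The state sum of an abstract graph with circle counts. -/

section StateSum

variable {V E : Type*} [Finite V] [DecidableEq V] [Fintype E] [DecidableEq E]
  {ends : E → Sym2 V} {b : Finset E → ℕ}

/-- A new edge that joins two components lowers the component count by one and `b` by at least one;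
any other edge raises `b` by at most one. So the defect `f` is monotone, and its values at the two
ends force it to be zero. -/
theorem circleCount_eq (hempty : b ∅ = Nat.card V)
    (hle : ∀ S, ∀ e ∉ S, b (insert e S) ≤ b S + 1)
    (hlt : ∀ S, ∀ e ∉ S, ∀ x y, ends e = s(x, y) →
      Quot.mk (fun x y : V => s(x, y) ∈ S.image ends) x ≠ Quot.mk _ y → b (insert e S) + 1 ≤ b S)
    (huniv : b Finset.univ + Nat.card V = Fintype.card E + 2)
    (hconn : componentCount (Finset.univ.image ends) ≤ 1) (S : Finset E) :
    b S + Nat.card V = 2 * componentCount (S.image ends) + S.card := by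
  let f : Finset E → ℤ := fun S =>
    2 * componentCount (S.image ends) + S.card - Nat.card V - b S
  have step (S : Finset E) (e : E) (he : e ∉ S) : f S ≤ f (insert e S) := by
    simp only [f, Finset.card_insert_of_notMem he, Finset.image_insert]
    have h1 := hle S e he
    have h2 := hlt S e he
    generalize ends e = z at h2
    induction z using Sym2.ind with | _ x y => ?_
    by_cases h : Quot.mk (fun x y : V => s(x, y) ∈ S.image ends) x = Quot.mk _ y
    · have : componentCount (S.image ends) ≤ componentCount (insert s(x, y) (S.image ends)) := by
        refine card_quot_le fun u v huv => ?_
        rcases Finset.mem_insert.1 huv with h' | h'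
        · rcases Sym2.eq_iff.1 h' with ⟨rfl, rfl⟩ | ⟨rfl, rfl⟩
          · exact h
          · exact h.symm
        · exact Quot.sound h'
      push_cast
      omega
    · have h3 := h2 x y rfl h
      have := componentCount_le_insert (S.image ends) s(x, y)
      push_cast
      omega
  have mono (S T : Finset E) : f S ≤ f (T ∪ S) := by
    induction T using Finset.induction_on with
    | empty => simp
    | insert e T _ ih =>
      rw [Finset.insert_union]
      by_cases h : e ∈ T ∪ S
      · rwa [Finset.insert_eq_of_mem h]
      · exact ih.trans (step _ _ h)
  have h0 : f ∅ ≤ f S := by simpa using mono ∅ S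
  have h1 : f S ≤ f Finset.univ := by
    have := mono S Finset.univ
    rwa [Finset.union_eq_left.2 (Finset.subset_univ S)] at this
  simp only [f, Finset.image_empty, Finset.card_empty, componentCount_empty, hempty,
    Finset.card_univ] at h0 h1
  omega

/-- The coefficient of `A ^ j` in the state sum of the circle counts `b`. -/
noncomputable def stateSumCoeff (b : Finset E → ℕ) (j : ℤ) : ℤ :=
  ∑ S : Finset E, circleCoeff (b S) (j - (Fintype.card E - 2 * S.card))

omit [Finite V] [DecidableEq E] in
-- By `hb`, the top degree `|E| - 2 |S| + 2 b S` of the term of `S` depends on `S` only through its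
-- component count.
theorem circleCoeff_stateSum_of_lt
    (hb : ∀ S, b S + Nat.card V = 2 * componentCount (S.image ends) + S.card)
    {S : Finset E} {j : ℤ}
    (h : Fintype.card E + 4 * componentCount (S.image ends) - 2 * Nat.card V < j) :
    circleCoeff (b S) (j - (Fintype.card E - 2 * S.card)) = 0 := by
  have := hb S
  exact circleCoeff_of_lt (by omega)

omit [Fintype E] [DecidableEq E] in
theorem componentCount_image_lt (hends : ∀ e, ¬ (ends e).IsDiag) {S : Finset E}
    (hS : S.Nonempty) : componentCount (S.image ends) + 1 ≤ Nat.card V :=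
  componentCount_lt_of_nonempty (by simpa using fun e _ => hends e) (hS.image ends)

omit [DecidableEq E] in
theorem stateSumCoeff_of_lt
    (hb : ∀ S, b S + Nat.card V = 2 * componentCount (S.image ends) + S.card)
    {j : ℤ} (h : Fintype.card E + 2 * Nat.card V < j) : stateSumCoeff b j = 0 := by
  refine Finset.sum_eq_zero fun S _ => circleCoeff_stateSum_of_lt hb ?_
  have := componentCount_anti (Finset.empty_subset (S.image ends))
  rw [componentCount_empty] at this
  omega

omit [DecidableEq E] in
theorem stateSumCoeff_top
    (hb : ∀ S, b S + Nat.card V = 2 * componentCount (S.image ends) + S.card)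
    (hends : ∀ e, ¬ (ends e).IsDiag) (hempty : b ∅ = Nat.card V) :
    stateSumCoeff b (Fintype.card E + 2 * Nat.card V) = (-1) ^ Nat.card V := by
  rw [stateSumCoeff, Finset.sum_eq_single ∅]
  · rw [hempty, ← circleCoeff_top]
    simp
  · intro S _ hS
    have := componentCount_image_lt hends (Finset.nonempty_iff_ne_empty.2 hS)
    exact circleCoeff_stateSum_of_lt hb (by omega)
  · simp

/-- Degree `k - 4` is reached only if `S` has rank one. Without loops this means that all edges of
`S` are parallel, so at most one summand on the right is nonzero. In that case `b S + 2 = |V| + |S|`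
gives the sign. -/
theorem circleCoeff_stateSum_sub_four
    (hb : ∀ S, b S + Nat.card V = 2 * componentCount (S.image ends) + S.card)
    (hends : ∀ e, ¬ (ends e).IsDiag) {S : Finset E} (hS : S.Nonempty) :
    circleCoeff (b S) (Fintype.card E + 2 * Nat.card V - 4 - (Fintype.card E - 2 * S.card)) =
      ∑ y ∈ Finset.univ.image ends,
        if S ⊆ Finset.univ.filter (fun e => ends e = y) then
          (-1) ^ Nat.card V * (-1) ^ S.card else 0 := by
  have hlt := componentCount_image_lt hends hS
  obtain ⟨e, he⟩ := hS
  by_cases hc : 1 < (S.image ends).card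
  · have := componentCount_add_two_le (by simpa using fun e _ => hends e) hc
    rw [circleCoeff_stateSum_of_lt hb (by omega), eq_comm]
    refine Finset.sum_eq_zero fun y _ => if_neg fun hy => ?_
    refine hc.not_ge (Finset.card_le_one.2 fun z hz w hw => ?_)
    obtain ⟨f, hf, rfl⟩ := Finset.mem_image.1 hz
    obtain ⟨g, hg, rfl⟩ := Finset.mem_image.1 hw
    exact (Finset.mem_filter.1 (hy hf)).2.trans (Finset.mem_filter.1 (hy hg)).2.symm
  · have hS' (f : E) (hf : f ∈ S) : ends f = ends e :=
      Finset.card_le_one.1 (not_lt.1 hc) _ (Finset.mem_image_of_mem _ hf) _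
        (Finset.mem_image_of_mem _ he)
    have hrank := card_le_componentCount_add (S.image ends)
    have hbS := hb S
    have hsub : S ⊆ Finset.univ.filter fun f => ends f = ends e :=
      fun f hf => Finset.mem_filter.2 ⟨Finset.mem_univ _, hS' f hf⟩
    rw [Finset.sum_eq_single (ends e)]
    · rw [if_pos hsub, ← pow_add,
        show (Fintype.card E + 2 * Nat.card V - 4 - (Fintype.card E - 2 * S.card) : ℤ) =
          2 * (b S : ℕ) by omega, circleCoeff_top,
        show Nat.card V + S.card = b S + 2 by omega, pow_add]
      simp
    · intro y _ hy
      refine if_neg fun h => hy ?_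
      exact (Finset.mem_filter.1 (h he)).2.symm
    · simp

theorem stateSumCoeff_sub_four
    (hb : ∀ S, b S + Nat.card V = 2 * componentCount (S.image ends) + S.card)
    (hends : ∀ e, ¬ (ends e).IsDiag) (hempty : b ∅ = Nat.card V) :
    stateSumCoeff b (Fintype.card E + 2 * Nat.card V - 4) =
      (-1) ^ Nat.card V * (Nat.card V - (Finset.univ.image ends).card) := by
  rw [stateSumCoeff, ← Finset.add_sum_erase _ _ (Finset.mem_univ ∅),
    Finset.sum_congr rfl fun S hS => circleCoeff_stateSum_sub_four hb hends
      (Finset.nonempty_iff_ne_empty.2 (Finset.ne_of_mem_erase hS)), Finset.sum_comm, hempty,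
    Finset.card_empty, show (Fintype.card E + 2 * Nat.card V - 4 -
      (Fintype.card E - 2 * (0 : ℕ)) : ℤ) = 2 * Nat.card V - 4 by push_cast; ring,
    circleCoeff_top_sub_four, mul_sub, sub_eq_add_neg]
  congr 1
  have (y) (hy : y ∈ Finset.univ.image ends) :
      ∑ S ∈ (Finset.univ : Finset (Finset E)).erase ∅,
        (if S ⊆ Finset.univ.filter (fun e => ends e = y) then
          ((-1) ^ Nat.card V * (-1) ^ S.card : ℤ) else 0) = -(-1) ^ Nat.card V := by
    obtain ⟨e, -, rfl⟩ := Finset.mem_image.1 hy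
    -- The alternating sum over all subsets of a parallel class is `0`; without the empty set it is
    -- `-1`.
    have h := Finset.sum_powerset_neg_one_pow_card_of_nonempty
      (x := Finset.univ.filter fun f => ends f = ends e) ⟨e, by simp⟩
    rw [← Finset.add_sum_erase _ _ (Finset.empty_mem_powerset _)] at h
    rw [← Finset.sum_filter, ← Finset.mul_sum,
      show ((Finset.univ : Finset (Finset E)).erase ∅).filter
        (fun S => S ⊆ Finset.univ.filter fun f => ends f = ends e) =
          (Finset.univ.filter fun f => ends f = ends e).powerset.erase ∅ by
        ext S; simp only [Finset.mem_filter, Finset.mem_erase, Finset.mem_powerset,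
          Finset.mem_univ, and_true]]
    rw [Finset.card_empty, pow_zero] at h
    rw [eq_neg_of_add_eq_zero_right h, mul_neg_one]
  rw [Finset.sum_congr rfl this]
  simp [mul_comm]

/-- The extreme coefficients of the state sum of a connected planar graph. -/
theorem stateSumCoeff_extreme (hempty : b ∅ = Nat.card V)
    (hle : ∀ S, ∀ e ∉ S, b (insert e S) ≤ b S + 1)
    (hlt : ∀ S, ∀ e ∉ S, ∀ x y, ends e = s(x, y) →
      Quot.mk (fun x y : V => s(x, y) ∈ S.image ends) x ≠ Quot.mk _ y → b (insert e S) + 1 ≤ b S)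
    (huniv : b Finset.univ + Nat.card V = Fintype.card E + 2)
    (hconn : componentCount (Finset.univ.image ends) ≤ 1)
    (hadequate : ∀ e, b {e} < b ∅) :
    ∃ k : ℤ, IsGreatest {j | stateSumCoeff b j ≠ 0} k ∧
      |stateSumCoeff b (k - 4) - stateSumCoeff b k| =
        (Finset.univ.image ends).card - Nat.card V + 1 := by
  have hb := circleCount_eq hempty hle hlt huniv hconn
  have hends (e : E) : ¬ (ends e).IsDiag := by
    -- A loop would leave `|V|` components, so `b {e} = |V| + 1` would exceed `b ∅`.
    intro he
    have h1 := hb {e}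
    have h2 := hadequate e
    have h3 : Nat.card V ≤ componentCount (({e} : Finset E).image ends) := by
      rw [← componentCount_empty]
      refine card_quot_le fun x y hxy => ?_
      rw [Finset.image_singleton, Finset.mem_singleton] at hxy
      rw [← hxy] at he
      have : x = y := by simpa using he
      rw [this]
    rw [Finset.card_singleton] at h1
    omega
  refine ⟨Fintype.card E + 2 * Nat.card V, ⟨?_, fun j hj => ?_⟩, ?_⟩
  · simp [stateSumCoeff_top hb hends hempty]
  · by_contra! h
    exact hj (stateSumCoeff_of_lt hb h)
  · have := card_le_componentCount_add (Finset.univ.image ends)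
    rw [stateSumCoeff_top hb hends hempty, stateSumCoeff_sub_four hb hends hempty, ← mul_sub_one,
      abs_mul, abs_pow, abs_neg, abs_one, one_pow, one_mul, abs_of_nonpos (by omega)]
    ring

end StateSum

/-! ### Parallel classes as fibres of the endpoint map. -/

section ReducedGraph

variable {V α β : Type*} [Fintype β] [DecidableEq V]

/-- Since `g` is injective, edges are parallel exactly when their values under `ends` agree; the
reduced edges are therefore counted by the image of `ends`. -/
theorem Graph.psi_reduced_eq {G : Graph α β} {ends : β → Sym2 V} {g : V → α}
    (hg : Function.Injective g) (hV : G.vertexSet = Set.range g)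
    (hE : ∀ e x y, G.IsLink e x y ↔ s(x, y) = (ends e).map g) :
    G.reduced.psi = (Finset.univ.image ends).card - Nat.card V + 1 := by
  have hpar (e f : β) : G.Parallel e f ↔ ends e = ends f := by
    constructor
    · rintro ⟨x, y, h, h'⟩
      exact Sym2.map.injective hg (((hE _ _ _).1 h).symm.trans ((hE _ _ _).1 h'))
    · intro h
      obtain ⟨x, y, hxy⟩ : ∃ x y, s(x, y) = (ends e).map g :=
        Sym2.ind (fun a b => ⟨a, b, rfl⟩) ((ends e).map g)
      exact ⟨x, y, (hE _ _ _).2 hxy, (hE _ _ _).2 (h ▸ hxy)⟩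
  have hedge : G.reduced.edgeSet =
      (fun z => {f | z = ends f}) '' (Finset.univ.image ends : Finset (Sym2 V)) := by
    ext p
    rw [Graph.edgeSet_eq_setOfPred_exists_isLink]
    simp only [Graph.reduced, hpar, Finset.coe_image, Finset.coe_univ, Set.image_univ,
      Set.mem_image, Set.mem_range, exists_exists_eq_and, Set.mem_ofPred_eq]
    constructor
    · rintro ⟨x, y, e, -, rfl⟩
      exact ⟨e, rfl⟩
    · rintro ⟨e, rfl⟩
      obtain ⟨x, y, h, -⟩ := (hpar e e).2 rfl
      exact ⟨x, y, e, h, rfl⟩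
  have hinj : Set.InjOn (fun z => {f | z = ends f})
      (Finset.univ.image ends : Finset (Sym2 V)) := by
    intro z hz w _ h
    obtain ⟨e, -, rfl⟩ := Finset.mem_image.1 hz
    have : e ∈ {f | w = ends f} := Set.ext_iff.1 h e |>.1 rfl
    exact this.symm
  rw [Graph.psi, hedge, hinj.ncard_image, Set.ncard_coe_finset,
    show G.reduced.vertexSet = Set.range g from hV, ← Set.image_univ,
    Set.ncard_image_of_injective _ hg, Set.ncard_univ]

end ReducedGraph

/-! ### Smoothings in a form uniform in the two constant states. -/

namespace LinkDiagram

open CrossingMap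

/-- The first end of a crossing that the smoothing `t` joins to its counterclockwise successor. -/
def base (t : Fin 2) : ZMod 4 := if t = 0 then 0 else 1

/-- The smoothing `t` joins the `i`-th end of a crossing to its counterclockwise successor. -/
def Cuts (t : Fin 2) (i : ZMod 4) : Prop := i = base t ∨ i = base t + 2

instance (t : Fin 2) (i : ZMod 4) : Decidable (Cuts t i) :=
  inferInstanceAs (Decidable (_ ∨ _))

theorem cuts_add_one : ∀ (t : Fin 2) (i : ZMod 4), Cuts t (i + 1) ↔ ¬ Cuts t i := by decide

theorem cuts_sub_one : ∀ (t : Fin 2) (i : ZMod 4), Cuts t (i - 1) ↔ ¬ Cuts t i := by decide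

theorem cuts_succ : ∀ (t : Fin 2) (i : ZMod 4), Cuts (t + 1) i ↔ ¬ Cuts t i := by decide

theorem cuts_base : ∀ t : Fin 2, Cuts t (base t) := by decide

theorem cuts_base_add_two : ∀ t : Fin 2, Cuts t (base t + 2) := by decide

theorem cuts_succ_base_add_one : ∀ t : Fin 2, Cuts (t + 1) (base t + 1) := by decide

theorem eq_base_add : ∀ (t : Fin 2) (j : ZMod 4),
    j = base t ∨ j = base t + 1 ∨ j = base t + 2 ∨ j = base t + 3 := by decide

theorem injective_base_add : ∀ t : Fin 2,
    Function.Injective ![base t, base t + 1, base t + 2, base t + 3] := by decide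

theorem partner_eq : ∀ (t : Fin 2) (j : ZMod 4),
    s(j, if Cuts t j then j + 1 else j - 1) = s(base t, base t + 1) ∨
    s(j, if Cuts t j then j + 1 else j - 1) = s(base t + 2, base t + 3) := by decide

variable (D : LinkDiagram)

theorem isOver_iff (t : Fin 2) (d : D.Dart) :
    IsOver d ↔ if t = 0 then ¬ Cuts t d.2 else Cuts t d.2 := by
  have : ∀ (t : Fin 2) (i : ZMod 4), (i = 1 ∨ i = 3) ↔ if t = 0 then ¬ Cuts t i else Cuts t i := by
    decide
  exact this t d.2

theorem smooth_eq (s : D.State) (d : D.Dart) :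
    D.smooth s d = (d.1, if Cuts (s d.1) d.2 then d.2 + 1 else d.2 - 1) := by
  have h := D.isOver_iff (s d.1) d
  unfold smooth
  split_ifs at h ⊢ <;> first | rfl | (exfalso; tauto)

theorem smooth_fst (s : D.State) (d : D.Dart) : (D.smooth s d).1 = d.1 := by rw [smooth_eq]

theorem cuts_smooth (s : D.State) (d : D.Dart) :
    Cuts (s d.1) (D.smooth s d).2 ↔ ¬ Cuts (s d.1) d.2 := by
  rw [smooth_eq]
  split_ifs with h
  · rw [cuts_add_one]
  · rw [cuts_sub_one]

theorem smooth_smooth (s : D.State) (d : D.Dart) : D.smooth s (D.smooth s d) = d := by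
  have h := D.cuts_smooth s d
  rw [D.smooth_eq s (D.smooth s d), smooth_fst]
  by_cases hd : Cuts (s d.1) d.2 <;> simp [h, hd] <;> simp [smooth_eq, hd]

theorem smooth_ne (s : D.State) (d : D.Dart) : D.smooth s d ≠ d := fun h => by
  have := D.cuts_smooth s d
  rw [h] at this
  tauto

variable {D} in
-- Both `Cuts t` and being over depend only on the parity of the end, and alternation says that an
-- edge changes this parity.
theorem Alternating.cuts_glue (h : D.Alternating) (t : Fin 2) (d : D.Dart) :
    Cuts t (D.glue d).2 ↔ ¬ Cuts t d.2 := by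
  have h := h d
  rw [isOver_iff D t, isOver_iff D t] at h
  by_cases ht : t = 0
  · simp only [if_pos ht, not_not] at h
    exact not_iff_comm.1 h |>.symm
  · simpa only [if_neg ht] using h

/-- Consecutive ends on a circle of the state `s`. -/
def CircleRel (s : D.State) : D.Dart → D.Dart → Prop := fun d e => e = D.glue d ∨ e = D.smooth s d

theorem mk_glue (s : D.State) (d : D.Dart) :
    Quot.mk (D.CircleRel s) (D.glue d) = Quot.mk (D.CircleRel s) d :=
  (Quot.sound (r := D.CircleRel s) (Or.inl rfl)).symm

theorem mk_smooth (s : D.State) (d : D.Dart) :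
    Quot.mk (D.CircleRel s) (D.smooth s d) = Quot.mk (D.CircleRel s) d :=
  (Quot.sound (r := D.CircleRel s) (Or.inr rfl)).symm

/-- The circles of the state `s`, crossingless components included. -/
abbrev Circle (s : D.State) : Type := Quot (D.CircleRel s) ⊕ Fin D.loops

instance (s : D.State) : Finite (Quot (D.CircleRel s)) :=
  Finite.of_surjective _ Quot.mk_surjective

theorem card_circle (s : D.State) : Nat.card (D.Circle s) = D.circles s := by
  rw [Nat.card_sum, Nat.card_fin]
  rfl

/-! ### Changing the smoothing of one crossing -/

/-- Ends joined outside the crossing `c`. -/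
def OuterRel (s : D.State) (c : Fin D.n) : D.Dart → D.Dart → Prop :=
  fun d e => e = D.glue d ∨ e = if d.1 = c then d else D.smooth s d

section Toggle

variable {D} {s s' : D.State} {c : Fin D.n} {t : Fin 2}

theorem outerRel_pairing (t : Fin 2) (s : D.State) (c : Fin D.n) :
    let q := fun i => Quot.mk (D.OuterRel s c) (c, i)
    (q (base t) = q (base t + 1) ∧ q (base t + 2) = q (base t + 3)) ∨
    (q (base t) = q (base t + 2) ∧ q (base t + 1) = q (base t + 3)) ∨
    (q (base t) = q (base t + 3) ∧ q (base t + 1) = q (base t + 2)) := by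
  -- With the crossing `c` left open, the fixed points of the smoothing involution are the four ends
  -- at `c`.
  refine pairing_of_involutions (α := D.glue)
    (β := fun d => if d.1 = c then d else D.smooth s d) (r := D.OuterRel s c) D.glue_glue
    D.glue_ne (fun d => ?_) (fun _ _ => Iff.rfl)
    (a := fun i => (c, ![base t, base t + 1, base t + 2, base t + 3] i)) ?_ ?_
  · by_cases h : d.1 = c
    · simp [h]
    · simp [h, smooth_fst, smooth_smooth]
  · intro i j hij
    exact injective_base_add t (congrArg Prod.snd hij)
  · rintro ⟨c', j⟩
    simp only [ite_eq_left_iff]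
    constructor
    · intro h
      have hc : c' = c := by
        by_contra hc
        exact D.smooth_ne s _ (h hc)
      subst hc
      rcases eq_base_add t j with rfl | rfl | rfl | rfl
      exacts [⟨0, rfl⟩, ⟨1, rfl⟩, ⟨2, rfl⟩, ⟨3, rfl⟩]
    · rintro ⟨i, hi⟩ h
      exact absurd (congrArg Prod.fst hi).symm h

theorem outerRel_of_circleRel (hs : s c = t) (x y : D.Dart) (h : D.CircleRel s x y) :
    D.OuterRel s c x y ∨ s(x, y) = s((c, base t), (c, base t + 1)) ∨
      s(x, y) = s((c, base t + 2), (c, base t + 3)) := by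
  rcases h with h | rfl
  · exact Or.inl (Or.inl h)
  by_cases hx : x.1 = c
  · right
    obtain ⟨c', j⟩ := x
    obtain rfl : c' = c := hx
    rw [smooth_eq, hs]
    exact (partner_eq t j).imp (congrArg (Sym2.map (Prod.mk c'))) (congrArg (Sym2.map (Prod.mk c')))
  · exact Or.inl (Or.inr (if_neg hx).symm)

theorem circleRel_of_outerRel (h : ∀ c' ≠ c, s' c' = s c') (x y : D.Dart)
    (hxy : D.OuterRel s c x y) : D.CircleRel s' x y ∨ x = y := by
  rcases hxy with h' | h'
  · exact Or.inl (Or.inl h')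
  · split_ifs at h' with hx
    · exact Or.inr h'.symm
    · exact Or.inl (Or.inr (by rw [h', smooth_eq, smooth_eq, h _ hx]))

theorem circleRel_of_cuts {i : ZMod 4} (h : Cuts (s c) i) :
    D.CircleRel s (c, i) (c, i + 1) := by
  right
  rw [smooth_eq, if_pos h]

theorem circles_toggle_le (hs : s c = t) (h : ∀ c' ≠ c, s' c' = s c') :
    D.circles s' ≤ D.circles s + 1 := by
  have := card_quot_reconnect_le (r := D.OuterRel s c) (R := D.CircleRel s) (R' := D.CircleRel s')
    (a := ![(c, base t), (c, base t + 1), (c, base t + 2), (c, base t + 3)])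
    (outerRel_pairing t s c) (outerRel_of_circleRel hs) (circleRel_of_outerRel h)
  change Nat.card (Quot (D.CircleRel s')) + _ ≤ Nat.card (Quot (D.CircleRel s)) + _ + 1
  omega

theorem circles_toggle_lt (hs : s c = t) (hs' : s' c = t + 1) (h : ∀ c' ≠ c, s' c' = s c')
    (hne : Quot.mk (D.CircleRel s) (c, base t) ≠ Quot.mk _ (c, base t + 2)) :
    D.circles s' + 1 ≤ D.circles s := by
  have h23 : D.CircleRel s (c, base t + 2) (c, base t + 3) := by
    have := circleRel_of_cuts (s := s) (c := c) (i := base t + 2)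
      (by rw [hs]; exact cuts_base_add_two t)
    rwa [show base t + 2 + 1 = base t + 3 by rw [add_assoc]; rfl] at this
  have h12 : D.CircleRel s' (c, base t + 1) (c, base t + 2) := by
    have := circleRel_of_cuts (s := s') (c := c) (i := base t + 1)
      (by rw [hs']; exact cuts_succ_base_add_one t)
    rwa [show base t + 1 + 1 = base t + 2 by rw [add_assoc]; rfl] at this
  have := card_quot_reconnect_lt (r := D.OuterRel s c) (R := D.CircleRel s) (R' := D.CircleRel s')
    (a := ![(c, base t), (c, base t + 1), (c, base t + 2), (c, base t + 3)])
    (outerRel_pairing t s c) (outerRel_of_circleRel hs) (circleRel_of_outerRel fun _ _ => rfl) h23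
    (circleRel_of_outerRel h) h12 hne
  change Nat.card (Quot (D.CircleRel s')) + _ + 1 ≤ Nat.card (Quot (D.CircleRel s)) + _
  omega

end Toggle

/-! ### Circles of the constant states and regions -/

/-- The face that contains the corner `d`. -/
def cornerFace (d : D.Dart) : D.Face := Quot.mk _ d

theorem cornerFace_nextCorner (d : D.Dart) : D.cornerFace (D.nextCorner d) = D.cornerFace d :=
  (Quot.sound (r := fun d e : D.Dart => e = D.nextCorner d) rfl).symm

variable {D} in
/-- The face to the side of a circle of the constant state `t` on which there are no crossings. -/
def circleFace (halt : D.Alternating) (t : Fin 2) :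
    Quot (D.CircleRel fun _ => t) → D.Face :=
  Quot.lift (fun d => if Cuts t d.2 then D.cornerFace d else D.cornerFace (D.smooth (fun _ => t) d))
    <| by
    -- Following a circle through an edge and the next smoothing is the same as going to the next
    -- corner of the face beside it.
    have key (d : D.Dart) (hd : Cuts t d.2) :
        D.smooth (fun _ => t) (D.glue d) = D.nextCorner d := by
      rw [smooth_eq, if_neg (by rwa [halt.cuts_glue, not_not]), nextCorner]
    rintro d e (rfl | rfl)
    · by_cases hd : Cuts t d.2
      · rw [if_pos hd, if_neg (by rwa [halt.cuts_glue, not_not]), key d hd,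
          cornerFace_nextCorner]
      · have hd' := (halt.cuts_glue t d).2 hd
        have := key _ hd'
        rw [D.glue_glue] at this
        rw [if_neg hd, if_pos hd', this, cornerFace_nextCorner]
    · have h := D.cuts_smooth (fun _ => t) d
      by_cases hd : Cuts t d.2
      · rw [if_pos hd, if_neg fun h' => h.1 h' hd, smooth_smooth]
      · rw [if_neg hd, if_pos (h.2 hd)]

variable {D} (halt : D.Alternating) (t : Fin 2)

theorem circleFace_of_cuts {d : D.Dart} (hd : Cuts t d.2) :
    circleFace halt t (Quot.mk _ d) = D.cornerFace d := if_pos hd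

theorem exists_cuts (q : Quot (D.CircleRel fun _ => t)) : ∃ d, Cuts t d.2 ∧ Quot.mk _ d = q := by
  induction q using Quot.ind with | mk d => ?_
  by_cases hd : Cuts t d.2
  · exact ⟨d, hd, rfl⟩
  · exact ⟨_, (D.cuts_smooth (fun _ => t) d).2 hd, D.mk_smooth _ d⟩

/-- In an alternating diagram, the faces correspond to the circles of the two constant states. -/
def faceEquiv : D.Face ≃ Quot (D.CircleRel fun _ => t) ⊕ Quot (D.CircleRel fun _ => t + 1) where
  toFun := Quot.lift (fun d => if Cuts t d.2 then Sum.inl (Quot.mk _ d) else Sum.inr (Quot.mk _ d))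
    (by
      have hnext (t : Fin 2) (d : D.Dart) (hd : Cuts t d.2) :
          Quot.mk (D.CircleRel fun _ => t) (D.nextCorner d) = Quot.mk _ d := by
        rw [← mk_glue _ _ d, ← mk_smooth _ _ (D.glue d), smooth_eq,
          if_neg (by rwa [halt.cuts_glue, not_not]), nextCorner]
      rintro d e rfl
      -- The edge and the step back by one corner each change parity, so all corners of a face have
      -- one colour.
      have hiff : Cuts t (D.nextCorner d).2 ↔ Cuts t d.2 := by
        rw [nextCorner, cuts_sub_one, halt.cuts_glue, not_not]
      by_cases hd : Cuts t d.2
      · rw [if_pos hd, if_pos (hiff.2 hd), hnext t d hd]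
      · rw [if_neg hd, if_neg (mt hiff.1 hd), hnext (t + 1) d ((cuts_succ t d.2).2 hd)])
  invFun := Sum.elim (circleFace halt t) (circleFace halt (t + 1))
  left_inv q := by
    induction q using Quot.ind with | mk d => ?_
    by_cases hd : Cuts t d.2
    · simp only [hd, if_true, Sum.elim_inl, circleFace_of_cuts halt t hd]
      rfl
    · simp only [hd, if_false, Sum.elim_inr,
        circleFace_of_cuts halt (t + 1) ((cuts_succ t d.2).2 hd)]
      rfl
  right_inv q := by
    rcases q with q | q
    · obtain ⟨d, hd, rfl⟩ := exists_cuts t q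
      rw [Sum.elim_inl, circleFace_of_cuts halt t hd]
      exact if_pos hd
    · obtain ⟨d, hd, rfl⟩ := exists_cuts (t + 1) q
      rw [Sum.elim_inr, circleFace_of_cuts halt (t + 1) hd]
      exact if_neg ((cuts_succ t d.2).1 hd)

theorem circleFace_injective : Function.Injective (circleFace halt t) :=
  (faceEquiv halt t).symm.injective.comp Sum.inl_injective

/-- The region inside a circle of the constant state `t`. -/
def circleRegion : D.Circle (fun _ => t) → D.Region :=
  -- The constant state `1` belongs to the black regions, and `true` marks the black side of a
  -- crossingless circle.
  Sum.map (circleFace halt t) fun j => (j, decide (t = 1))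

theorem circleRegion_injective : Function.Injective (circleRegion halt t) :=
  (circleFace_injective halt t).sumMap fun _ _ h => congrArg Prod.fst h

theorem range_circleRegion : Set.range (circleRegion halt t) =
    {r | (∃ c, r = D.cornerRegion c (base t) ∨ r = D.cornerRegion c (base t + 2)) ∨
      ∃ j, r = Sum.inr (j, decide (t = 1))} := by
  ext r
  constructor
  · rintro ⟨q | j, rfl⟩
    · obtain ⟨⟨c, i⟩, hd, rfl⟩ := exists_cuts t q
      left
      refine ⟨c, ?_⟩
      rw [circleRegion, Sum.map_inl, circleFace_of_cuts halt t hd]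
      rcases hd with rfl | rfl
      exacts [Or.inl rfl, Or.inr rfl]
    · exact Or.inr ⟨j, rfl⟩
  · rintro (⟨c, rfl | rfl⟩ | ⟨j, rfl⟩)
    · exact ⟨Sum.inl (Quot.mk _ (c, base t)),
        congrArg Sum.inl (circleFace_of_cuts halt t (cuts_base t))⟩
    · exact ⟨Sum.inl (Quot.mk _ (c, base t + 2)),
        congrArg Sum.inl (circleFace_of_cuts halt t (cuts_base_add_two t))⟩
    · exact ⟨Sum.inr j, rfl⟩

/-- The circles of the constant state `t` that meet at the crossing `c`. -/
def circleEnds (D : LinkDiagram) (t : Fin 2) (c : Fin D.n) : Sym2 (D.Circle fun _ => t) :=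
  s(Sum.inl (Quot.mk _ (c, base t)), Sum.inl (Quot.mk _ (c, base t + 2)))

theorem map_circleEnds (c : Fin D.n) : (D.circleEnds t c).map (circleRegion halt t) =
    s(D.cornerRegion c (base t), D.cornerRegion c (base t + 2)) := by
  rw [circleEnds, Sym2.map_mk, circleRegion, Sum.map_inl, Sum.map_inl,
    circleFace_of_cuts halt t (cuts_base t), circleFace_of_cuts halt t (cuts_base_add_two t)]
  rfl

/-! ### The states as subgraphs -/

/-- The state with entry `t + 1` on `S` and `t` elsewhere. -/
def flipState (D : LinkDiagram) (t : Fin 2) (S : Finset (Fin D.n)) : D.State :=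
  fun c => if c ∈ S then t + 1 else t

theorem flipState_empty : D.flipState t ∅ = fun _ => t := by
  funext c
  simp [flipState]

theorem flipState_univ : D.flipState t Finset.univ = fun _ => t + 1 := by
  funext c
  simp [flipState]

theorem flipState_singleton (c : Fin D.n) :
    D.flipState t {c} = Function.update (fun _ => t) c (t + 1) := by
  funext c'
  simp [flipState, Function.update_apply]

theorem mk_end_eq (c : Fin D.n) (i : ZMod 4) :
    Quot.mk (D.CircleRel fun _ => t) (c, i) = Quot.mk _ (c, base t) ∨
      Quot.mk (D.CircleRel fun _ => t) (c, i) = Quot.mk _ (c, base t + 2) := by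
  rcases eq_base_add t i with rfl | rfl | rfl | rfl
  · exact Or.inl rfl
  · exact Or.inl (Quot.sound (circleRel_of_cuts (s := fun _ => t) (cuts_base t))).symm
  · exact Or.inr rfl
  · have := circleRel_of_cuts (D := D) (s := fun _ => t) (c := c) (cuts_base_add_two t)
    rw [show base t + 2 + 1 = base t + 3 by rw [add_assoc]; rfl] at this
    exact Or.inr (Quot.sound this).symm

open Classical in
/-- The component of the end `d`, when the circles of the constant state `t` are connected at the
crossings in `S`. -/
noncomputable def componentOf (D : LinkDiagram) (t : Fin 2) (S : Finset (Fin D.n)) (d : D.Dart) :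
    Quot fun x y : D.Circle (fun _ => t) => s(x, y) ∈ S.image (D.circleEnds t) :=
  Quot.mk _ (Sum.inl (Quot.mk _ d))

theorem componentOf_glue (S : Finset (Fin D.n)) (d : D.Dart) :
    D.componentOf t S (D.glue d) = D.componentOf t S d := by
  rw [componentOf, mk_glue, componentOf]

theorem componentOf_eq {S : Finset (Fin D.n)} {c : Fin D.n} (hc : c ∈ S) (i j : ZMod 4) :
    D.componentOf t S (c, i) = D.componentOf t S (c, j) := by
  have h2 : D.componentOf t S (c, base t) = D.componentOf t S (c, base t + 2) :=
    Quot.sound (by classical exact Finset.mem_image_of_mem (D.circleEnds t) hc)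
  have key (i : ZMod 4) : D.componentOf t S (c, i) = D.componentOf t S (c, base t) := by
    rcases mk_end_eq t c i with h | h
    · rw [componentOf, h, componentOf]
    · rw [h2, componentOf, h, componentOf]
  rw [key, key j]

theorem componentOf_smooth (S : Finset (Fin D.n)) (d : D.Dart) :
    D.componentOf t S (D.smooth (D.flipState t S) d) = D.componentOf t S d := by
  by_cases hd : d.1 ∈ S
  · rw [smooth_eq]
    exact componentOf_eq t hd _ _
  · have : D.smooth (D.flipState t S) d = D.smooth (fun _ => t) d := by
      rw [smooth_eq, smooth_eq, flipState, if_neg hd]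
    rw [this, componentOf, mk_smooth, componentOf]

/-- A circle of the flipped state changes from one circle of the state `t` to another only at
crossings in `S`, so it stays within one component of `(V, S)`. -/
theorem componentOf_eq_of_mk {S : Finset (Fin D.n)} {d e : D.Dart}
    (h : Quot.mk (D.CircleRel (D.flipState t S)) d = Quot.mk _ e) :
    D.componentOf t S d = D.componentOf t S e :=
  congrArg (Quot.lift (D.componentOf t S) (by
    rintro x y (rfl | rfl)
    exacts [(componentOf_glue t S x).symm, (componentOf_smooth t S x).symm])) h

open Classical in
-- Ends in different components lie on different circles of the state of `S`, and changing the
-- smoothing at `c` merges these two circles.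
theorem circles_flipState_insert_lt {S : Finset (Fin D.n)} {c : Fin D.n} (hc : c ∉ S)
    {x y : D.Circle fun _ => t} (hxy : D.circleEnds t c = s(x, y))
    (hne : Quot.mk (fun x y => s(x, y) ∈ S.image (D.circleEnds t)) x ≠ Quot.mk _ y) :
    D.circles (D.flipState t (insert c S)) + 1 ≤ D.circles (D.flipState t S) := by
  refine circles_toggle_lt (c := c) (t := t) (if_neg hc) (if_pos (Finset.mem_insert_self _ _))
    (fun c' hc' => by simp [flipState, hc']) fun h => hne ?_
  have h' := componentOf_eq_of_mk t h
  rcases Sym2.eq_iff.1 hxy with ⟨rfl, rfl⟩ | ⟨rfl, rfl⟩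
  exacts [h', h'.symm]

open Classical in
theorem circles_flipState_insert_le {S : Finset (Fin D.n)} {c : Fin D.n} (hc : c ∉ S) :
    D.circles (D.flipState t (insert c S)) ≤ D.circles (D.flipState t S) + 1 :=
  circles_toggle_le (c := c) (t := t) (if_neg hc) fun c' hc' => by simp [flipState, hc']

include halt in
-- The two constant states together have one circle per face, and each crossingless circle counts
-- twice; Euler's formula does the rest.
theorem circles_add_circles (hconn : D.Connected) :
    D.circles (fun _ => t + 1) + D.circles (fun _ => t) = D.n + 2 := by
  have h1 := D.planar
  have h2 := Nat.card_congr (faceEquiv halt t)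
  rw [Nat.card_sum] at h2
  rw [← card_circle, ← card_circle, Nat.card_sum, Nat.card_sum, Nat.card_fin]
  unfold Connected at hconn
  omega

open Classical in
-- The components of the diagram, crossingless circles included, map onto those of the graph.
theorem componentCount_circleEnds_le (hconn : D.Connected) :
    componentCount (Finset.univ.image (D.circleEnds t)) ≤ 1 := by
  have : Finite D.Component := Finite.of_surjective _ Quot.mk_surjective
  have h : Nat.card (D.Component ⊕ Fin D.loops) = 1 := by
    rw [Nat.card_sum, Nat.card_fin]
    exact hconn
  rw [← h]
  refine Nat.card_le_card_of_surjective (Sum.elim (Quot.lift (D.componentOf t Finset.univ) ?_)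
    fun j => Quot.mk _ (Sum.inr j)) ?_
  · rintro d e (rfl | rfl)
    · exact (componentOf_glue t _ d).symm
    · exact componentOf_eq t (Finset.mem_univ d.1) d.2 (d.2 + 1)
  · intro q
    induction q using Quot.ind with | mk q => ?_
    rcases q with q | j
    · induction q using Quot.ind with | mk d => ?_
      exact ⟨Sum.inl (Quot.mk _ d), rfl⟩
    · exact ⟨Sum.inr j, rfl⟩

/-! ### The bracket -/

theorem coeff_eq_sum (D : LinkDiagram) (j : ℤ) :
    D.coeff j = ∑ s : D.State, circleCoeff (D.circles s) (j - D.sigma s) := by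
  rw [coeff, bracket, AddMonoidAlgebra.coeff_sum, Finsupp.finsetSum_apply]
  exact Finset.sum_congr rfl fun s _ => coeff_T_mul _ _ _

theorem sum_state_eq (t : Fin 2) (f : D.State → ℤ) :
    ∑ s, f s = ∑ S : Finset (Fin D.n), f (D.flipState t S) := by
  refine (Finset.sum_bij' (fun S _ => D.flipState t S)
    (fun s _ => Finset.univ.filter fun c => s c ≠ t) (by simp) (by simp) ?_ ?_ (by simp)).symm
  · intro S _
    ext c
    by_cases h : c ∈ S <;> simp [flipState, h]
  · intro s _
    funext c
    have : ∀ t u : Fin 2, (if u ≠ t then t + 1 else t) = u := by decide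
    simpa [flipState] using this t (s c)

theorem filter_flipState (S : Finset (Fin D.n)) :
    (Finset.univ.filter fun c => D.flipState t S c = t) = Sᶜ ∧
      (Finset.univ.filter fun c => D.flipState t S c = t + 1) = S := by
  constructor <;> ext c <;> by_cases h : c ∈ S <;> simp [flipState, h]

theorem card_compl_int (S : Finset (Fin D.n)) : ((Sᶜ.card : ℕ) : ℤ) = D.n - S.card := by
  have := S.card_compl_add_card
  rw [Fintype.card_fin] at this
  omega

theorem sigma_flipState_zero (S : Finset (Fin D.n)) :
    D.sigma (D.flipState 0 S) = D.n - 2 * S.card := by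
  obtain ⟨h1, h2⟩ := filter_flipState (D := D) 0 S
  rw [zero_add] at h2
  rw [sigma, h1, h2, card_compl_int]
  ring

theorem sigma_flipState_one (S : Finset (Fin D.n)) :
    D.sigma (D.flipState 1 S) = -(D.n - 2 * S.card) := by
  obtain ⟨h1, h2⟩ := filter_flipState (D := D) 1 S
  rw [show (1 + 1 : Fin 2) = 0 from rfl] at h2
  rw [sigma, h1, h2, card_compl_int]
  ring

theorem coeff_eq_stateSumCoeff_zero (j : ℤ) :
    D.coeff j = stateSumCoeff (fun S => D.circles (D.flipState 0 S)) j := by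
  rw [coeff_eq_sum, sum_state_eq 0, stateSumCoeff]
  simp only [sigma_flipState_zero, Fintype.card_fin]

/-- Starting from the state `1` reverses the sign of `sigma`, which `circleCoeff_neg` absorbs into
the degree. -/
theorem coeff_eq_stateSumCoeff_one (j : ℤ) :
    D.coeff j = stateSumCoeff (fun S => D.circles (D.flipState 1 S)) (-j) := by
  rw [coeff_eq_sum, sum_state_eq 1, stateSumCoeff]
  refine Finset.sum_congr rfl fun S _ => ?_
  rw [sigma_flipState_one, ← circleCoeff_neg, Fintype.card_fin]
  congr 1
  ring

include halt in
-- Both halves of the theorem at once: the abstract state sum applied to the circles of the constant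
-- state `t`, with `G` identified through `circleRegion`.
theorem stateSumCoeff_circles (hconn : D.Connected)
    (hadequate : ∀ c, D.circles (Function.update (fun _ => t) c (t + 1)) < D.circles fun _ => t)
    {G : Graph D.Region (Fin D.n)} (hV : G.vertexSet = Set.range (circleRegion halt t))
    (hE : ∀ c x y, G.IsLink c x y ↔
      s(x, y) = s(D.cornerRegion c (base t), D.cornerRegion c (base t + 2))) :
    ∃ k : ℤ, IsGreatest {j | stateSumCoeff (fun S => D.circles (D.flipState t S)) j ≠ 0} k ∧
      |stateSumCoeff (fun S => D.circles (D.flipState t S)) (k - 4) -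
        stateSumCoeff (fun S => D.circles (D.flipState t S)) k| = G.reduced.psi := by
  classical
  rw [Graph.psi_reduced_eq (circleRegion_injective halt t) hV (ends := D.circleEnds t)
    fun c x y => by rw [hE, map_circleEnds]]
  refine stateSumCoeff_extreme ?_ (fun S c hc => ?_)
    (fun S c hc x y hxy hne => ?_) ?_ (componentCount_circleEnds_le t hconn) fun c => ?_
  · rw [flipState_empty, card_circle]
  · convert circles_flipState_insert_le t hc
  · convert circles_flipState_insert_lt t hc hxy hne
  · rw [flipState_univ, card_circle, Fintype.card_fin, circles_add_circles halt t hconn]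
  · rw [flipState_empty, flipState_singleton]
    exact hadequate c

end LinkDiagram

theorem mainTheorem1 (D : LinkDiagram) (hconn : D.Connected) (halt : D.Alternating) :
    (D.PlusAdequate → ∃ k : ℤ, IsGreatest {j : ℤ | D.coeff j ≠ 0} k ∧
      |D.coeff (k - 4) - D.coeff k| = D.whiteGraph.reduced.psi) ∧
    (D.MinusAdequate → ∃ l : ℤ, IsLeast {j : ℤ | D.coeff j ≠ 0} l ∧
      |D.coeff (l + 4) - D.coeff l| = D.blackGraph.reduced.psi) := by
  constructor
  · intro h
    simp only [LinkDiagram.coeff_eq_stateSumCoeff_zero]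
    exact LinkDiagram.stateSumCoeff_circles halt 0 hconn h
      (LinkDiagram.range_circleRegion halt 0).symm
      fun _ _ _ => Iff.rfl
  · intro h
    -- In `Fin 2`, `1 + 1` is `0`, so `h` is the adequacy hypothesis for `t = 1`; the corners `base
    -- 1` and `base 1 + 2` are the black ones `1` and `3`.
    obtain ⟨k, hk, hpsi⟩ := LinkDiagram.stateSumCoeff_circles halt 1 hconn h
      (G := D.blackGraph) (LinkDiagram.range_circleRegion halt 1).symm fun _ _ _ => Iff.rfl
    simp only [LinkDiagram.coeff_eq_stateSumCoeff_one]
    -- With `l = -k`, degree `l + 4` of the bracket is degree `k - 4` of the state sum.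
    refine ⟨-k, ⟨by simpa using hk.1, fun j hj => neg_le.1 (hk.2 hj)⟩, ?_⟩
    rw [← hpsi, neg_add, neg_neg, ← sub_eq_add_neg]
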